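/- Let $\mathcal C$ be a regular category: it has finite limits, every kernel pair in $\mathcal C$ has a coequalizer, and regular epimorphisms are stable under pullback. Let $\mathbb{R}\mathbf{el}(\mathcal C)$ be the virtual double category of internal relations in $\mathcal C$: its vertical category is $\mathcal C$, a proarrow $R\colon a\nrightarrow b$ is a monomorphism $R\hookrightarrow b\times a$, and a 2-cell $R_1,\dots,R_n\to S$ ($n\ge 0$) with left frame $f\colon c_0\to c$ and right frame $g\colon c_n\to d$ is a morphism $R_1\times_{c_1}\cdots\times_{c_{n-1}}R_n\to S$ forming a commutative square with $g\times f\colon c_n\times c_0\to d\times c$ (for $n=0$ the source is $c_0$). Its units are the diagonals and its restrictions are given by pullback along $g\times f$, so it is a virtual equipment. Terminology, in a virtual equipment. An embedding of a monoid $M\colon c\nrightarrow c$ into an object $x$ is a monoid homomorphism $(f,\vec f\,)$ from $M$ to the trivial monoid (the unit proarrow $U_x$) on $x$; an embedding of an $(M,N)$-bimodule $B$ into a proarrow $P\colon x\nrightarrow y$ over embeddings $f\colon M\to x$, $g\colon N\to y$ is a bimodule homomorphism $B\to P$ over $f$ and $g$, where $P$ is regarded as a bimodule between trivial monoids. A collapse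 of $M$ is a universal embedding of $M$ into an object; a collapse of $B$ is an embedding of $B$ over collapses of $M$ and $N$ through which every embedding of $B$ into a proarrow factors uniquely. A collapse $(i,\vec\imath\,)\colon M\to x$ is normal if $\vec\imath\colon M\to U_x$ is also a collapse of the $(M,M)$-bimodule $M$. A monoid $M$ is a kernel of $f\colon c\to d$ if there is an embedding $(f,\vec f\,)\colon M\to d$ with $\vec f$ a cartesian cell; $M$ is effective if it is a kernel of some vertical arrow; $f$ is a regular cover if this cell $\vec f$ is a normal collapse. A virtual equipment is regular if (1) every effective monoid has a normal collapse, and (2) for every proarrow $B\colon d\nrightarrow d'$ and all regular covers $f\colon c\to d$ and $g\colon c'\to d'$, the cartesian embedding $B(g,f)\to B$ of the $(\ker f,\ker g)$-bimodule $B(g,f)$ is a bimodule collapse. Then: 1. $\mathbb{R}\mathbf{el}(\mathcal C)$ has all composites of proarrows (so it is an equipment), and it is a regular virtual equipment. 2. Every morphism $f$ of $\mathcal C$ has a kernel in $\mathbb{R}\mathbf{el}(\mathcal C)$, and a monoid $M\hookrightarrow a\times a$ in $\mathbb{R}\mathbf{el}(\mathcal C)$ is a kernel of $f\colon a\to b$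 if and only if its two projections $M\rightrightarrows a$ form a kernel pair of $f$ in $\mathcal C$. In particular, the effective monoids are exactly the monoids given by kernel pairs. 3. If $M\hookrightarrow a\times a$ is an effective monoid and $q\colon a\to x$ is a coequalizer in $\mathcal C$ of its two projections $M\rightrightarrows a$, then $q$ underlies a normal collapse of $M$. -/

import Mathlib

open CategoryTheory CategoryTheory.Limits

universe w w' v u

/-! ### Virtual double categories -/

/-- Composable strings `A₁, …, Aₙ` (`n ≥ 0`) of proarrows. -/
inductive ProPath {D : Type u} (H : D → D → Type w) : D → D → Type (max u w)
  | nil (a : D) : ProPath H a a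
  | cons {a b c : D} (A : H a b) (P : ProPath H b c) : ProPath H a c

namespace ProPath

variable {D : Type u} {H : D → D → Type w}

/-- Concatenation of strings of proarrows. -/
def append {a b c : D} : ProPath H a b → ProPath H b c → ProPath H a c
  | nil _, Q => Q
  | cons A P, Q => cons A (P.append Q)

/-- The string consisting of one proarrow. -/
abbrev single {a b : D} (A : H a b) : ProPath H a b := cons A (nil b)

/-- The string consisting of two proarrows. -/
abbrev pair {a b c : D} (A : H a b) (B : H b c) : ProPath H a c := cons A (single B)

theorem append_nil {a b : D} (P : ProPath H a b) : P.append (nil b) = P := by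
  induction P with
  | nil => rfl
  | cons A P ih => simp only [append, ih]

theorem append_assoc {a b c d : D} (P : ProPath H a b) (Q : ProPath H b c) (R : ProPath H c d) :
    (P.append Q).append R = P.append (Q.append R) := by
  induction P with
  | nil => rfl
  | cons A P ih => simp only [append, ih]

end ProPath

/-- The proarrows and the cells of a virtual double category with vertical category `D`, before
identities and composition. `Cell P f g B` is the set of cells with multi-source the string `P`,
left frame `f`, right frame `g` and target `B`. -/
structure VirtualDoubleGraph (D : Type u) [Category.{v} D] where
  Pro : D → D → Type w
  Cell : {a b c d : D} → ProPath Pro a b → (a ⟶ c) → (b ⟶ d) → Pro c d → Type w'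

/-- Horizontally composable strings of cells `ψ₁, …, ψₙ`: the target of `ψᵢ` is the `i`-th member
of the string `P`, the right frame of each `ψᵢ` is the left frame of the next one, and `Q` is the
concatenation of the multi-sources of the `ψᵢ`. The outermost frames are `h` and `k`. -/
inductive CellPath {D : Type u} [Category.{v} D] (G : VirtualDoubleGraph.{w, w'} D) :
    {a b c d : D} → ProPath G.Pro a b → ProPath G.Pro c d → (a ⟶ c) → (b ⟶ d) →
      Type (max u v w w')
  | nil {a c : D} (h : a ⟶ c) : CellPath G (.nil a) (.nil c) h h
  | cons {a b e c d i : D} {R : ProPath G.Pro a e} {Q : ProPath G.Pro a b}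
      {Q' : ProPath G.Pro b e} {A : G.Pro c d} {P : ProPath G.Pro d i}
      {h : a ⟶ c} {k : b ⟶ d} {l : e ⟶ i} (ψ : G.Cell Q h k A) (Ψ : CellPath G Q' P k l)
      (hR : R = Q.append Q') : CellPath G R (.cons A P) h l

namespace CellPath

variable {D : Type u} [Category.{v} D] {G : VirtualDoubleGraph.{w, w'} D}

/-- The string consisting of one cell. -/
def single {a b c d : D} {Q : ProPath G.Pro a b} {A : G.Pro c d} {h : a ⟶ c} {k : b ⟶ d}
    (ψ : G.Cell Q h k A) : CellPath G Q (.single A) h k :=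
  cons ψ (nil k) Q.append_nil.symm

/-- The string consisting of two cells. -/
def pair {a b e c d i : D} {Q : ProPath G.Pro a b} {Q' : ProPath G.Pro b e} {A : G.Pro c d}
    {B : G.Pro d i} {h : a ⟶ c} {k : b ⟶ d} {l : e ⟶ i} (ψ : G.Cell Q h k A)
    (ψ' : G.Cell Q' k l B) : CellPath G (Q.append Q') (.pair A B) h l :=
  cons ψ (single ψ') rfl

/-- Concatenation of strings of cells. -/
def append {a b c d : D} {Q : ProPath G.Pro a b} {P : ProPath G.Pro c d} {h : a ⟶ c} {k : b ⟶ d} :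
    {e i : D} → {Q' : ProPath G.Pro b e} → {P' : ProPath G.Pro d i} → {l : e ⟶ i} →
    CellPath G Q P h k → CellPath G Q' P' k l → CellPath G (Q.append Q') (P.append P') h l
  | _, _, _, _, _, nil _, Ψ' => Ψ'
  | _, _, Q', _, _, cons (Q := Q₁) (Q' := Q₂) ψ Ψ hR, Ψ' =>
      cons ψ (Ψ.append Ψ') (by rw [hR, ProPath.append_assoc])

/-- The string of identity cells of a string of proarrows. -/
def ids (i : ∀ {a b : D} (A : G.Pro a b), G.Cell (.single A) (𝟙 a) (𝟙 b) A) :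
    {a b : D} → (P : ProPath G.Pro a b) → CellPath G P P (𝟙 a) (𝟙 b)
  | _, _, .nil a => nil (𝟙 a)
  | _, _, .cons A P => cons (i A) (ids i P) rfl

/-- `IsVComp @comp Θ Ψ Ξ`: the string `Ψ` is `ψ₁, …, ψₙ`, the string `Θ` is the concatenation of
strings `Θ₁, …, Θₙ`, where the targets of `Θᵢ` form the multi-source of `ψᵢ`, and `Ξ` is
the string of the composites of `Θᵢ` with `ψᵢ`. -/
inductive IsVComp
    (comp : ∀ {a b c d x y : D} {Q : ProPath G.Pro a b} {P : ProPath G.Pro c d} {B : G.Pro x y}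
      {h : a ⟶ c} {k : b ⟶ d} {f : c ⟶ x} {g : d ⟶ y} {f' : a ⟶ x} {g' : b ⟶ y},
      CellPath G Q P h k → G.Cell P f g B → h ≫ f = f' → k ≫ g = g' → G.Cell Q f' g' B) :
    ∀ {a b c d x y : D} {R : ProPath G.Pro a b} {Q : ProPath G.Pro c d} {P : ProPath G.Pro x y}
      {h : a ⟶ c} {k : b ⟶ d} {f : c ⟶ x} {g : d ⟶ y} {f' : a ⟶ x} {g' : b ⟶ y},
      CellPath G R Q h k → CellPath G Q P f g → CellPath G R P f' g' → Prop
  | nil {a b c : D} (h : a ⟶ b) (f : b ⟶ c) (f' : a ⟶ c) (hf : h ≫ f = f') :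
      IsVComp @comp (nil h) (nil f) (nil f')
  | cons {a b e c d i x y z : D} {R₁ : ProPath G.Pro a b} {R₂ : ProPath G.Pro b e}
      {Q₁ : ProPath G.Pro c d} {Q₂ : ProPath G.Pro d i} {A : G.Pro x y} {P : ProPath G.Pro y z}
      {h : a ⟶ c} {k : b ⟶ d} {l : e ⟶ i} {f : c ⟶ x} {g : d ⟶ y} {j : i ⟶ z}
      {f' : a ⟶ x} {g' : b ⟶ y} {j' : e ⟶ z}
      (Θ₁ : CellPath G R₁ Q₁ h k) (Θ₂ : CellPath G R₂ Q₂ k l)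
      (ψ : G.Cell Q₁ f g A) (Ψ : CellPath G Q₂ P g j) (Ξ : CellPath G R₂ P g' j')
      (hf : h ≫ f = f') (hg : k ≫ g = g') (H : IsVComp @comp Θ₂ Ψ Ξ) :
      IsVComp @comp (Θ₁.append Θ₂) (cons ψ Ψ rfl) (cons (comp Θ₁ ψ hf hg) Ξ rfl)

theorem cons_heq {a b e c d i : D} {R R' : ProPath G.Pro a e} {Q : ProPath G.Pro a b}
    {Q' Q'' : ProPath G.Pro b e} {A : G.Pro c d} {P P' : ProPath G.Pro d i}
    {h : a ⟶ c} {k : b ⟶ d} {l : e ⟶ i} (ψ : G.Cell Q h k A) (Ψ : CellPath G Q' P k l)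
    (Ψ' : CellPath G Q'' P' k l) (hR : R = Q.append Q') (hR' : R' = Q.append Q'')
    (hQ : Q' = Q'') (hP : P = P') (hΨ : HEq Ψ Ψ') : HEq (cons ψ Ψ hR) (cons ψ Ψ' hR') := by
  subst hR hR' hQ hP hΨ
  rfl

theorem append_nil_heq {a b c d : D} {Q : ProPath G.Pro a b} {P : ProPath G.Pro c d} {h : a ⟶ c}
    {k : b ⟶ d} (Ψ : CellPath G Q P h k) : HEq (Ψ.append (nil k)) Ψ := by
  induction Ψ with
  | nil h => rfl
  | cons ψ Ψ hR ih => exact cons_heq _ _ _ _ _ (ProPath.append_nil _) (ProPath.append_nil _) ih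

end CellPath

/-- A virtual double category with vertical category `D`. The composite of a string of cells
`Ψ` with a cell `φ` has left frame `h ≫ f` and right frame `k ≫ g`; in `comp` these frames may be
given by any arrows `f'`, `g'` equal to them, so that the laws are equations in one set of
cells. -/
structure VirtualDoubleCategory (D : Type u) [Category.{v} D] extends
    VirtualDoubleGraph.{w, w'} D where
  idCell : ∀ {a b : D} (A : Pro a b), Cell (.single A) (𝟙 a) (𝟙 b) A
  comp : ∀ {a b c d x y : D} {Q : ProPath Pro a b} {P : ProPath Pro c d} {B : Pro x y}
    {h : a ⟶ c} {k : b ⟶ d} {f : c ⟶ x} {g : d ⟶ y} {f' : a ⟶ x} {g' : b ⟶ y},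
    CellPath toVirtualDoubleGraph Q P h k → Cell P f g B → h ≫ f = f' → k ≫ g = g' →
      Cell Q f' g' B
  ids_comp : ∀ {a b c d : D} {P : ProPath Pro a b} {B : Pro c d} {f : a ⟶ c} {g : b ⟶ d}
    (φ : Cell P f g B),
    comp (CellPath.ids idCell P) φ (Category.id_comp f) (Category.id_comp g) = φ
  comp_id : ∀ {a b c d : D} {P : ProPath Pro a b} {B : Pro c d} {f : a ⟶ c} {g : b ⟶ d}
    (φ : Cell P f g B),
    comp (CellPath.single φ) (idCell B) (Category.comp_id f) (Category.comp_id g) = φ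
  assoc : ∀ {a b c d p q x y : D} {R : ProPath Pro a b} {Q : ProPath Pro c d}
    {P : ProPath Pro p q} {B : Pro x y} {h : a ⟶ c} {k : b ⟶ d} {f : c ⟶ p} {g : d ⟶ q}
    {hf : a ⟶ p} {kg : b ⟶ q} {r : p ⟶ x} {s : q ⟶ y} {fr : c ⟶ x} {gs : d ⟶ y}
    {t : a ⟶ x} {t' : b ⟶ y}
    (Θ : CellPath toVirtualDoubleGraph R Q h k) (Ψ : CellPath toVirtualDoubleGraph Q P f g)
    (Ξ : CellPath toVirtualDoubleGraph R P hf kg) (φ : Cell P r s B)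
    (e₁ : f ≫ r = fr) (e₂ : g ≫ s = gs) (e₃ : h ≫ fr = t) (e₄ : k ≫ gs = t')
    (e₅ : hf ≫ r = t) (e₆ : kg ≫ s = t'),
    CellPath.IsVComp @comp Θ Ψ Ξ → comp Θ (comp Ψ φ e₁ e₂) e₃ e₄ = comp Ξ φ e₅ e₆

namespace VirtualDoubleCategory

variable {D : Type u} [Category.{v} D] (𝔻 : VirtualDoubleCategory.{w, w'} D)

/-- Strings of proarrows of `𝔻`. -/
abbrev Path (a b : D) := ProPath 𝔻.Pro a b

/-- Strings of cells of `𝔻`. -/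
abbrev Cells {a b c d : D} (Q : 𝔻.Path a b) (P : 𝔻.Path c d) (h : a ⟶ c) (k : b ⟶ d) :=
  CellPath 𝔻.toVirtualDoubleGraph Q P h k

variable {𝔻}

/-- The string of identity cells of a string of proarrows. -/
abbrev idCells {a b : D} (P : 𝔻.Path a b) : 𝔻.Cells P P (𝟙 a) (𝟙 b) :=
  CellPath.ids 𝔻.idCell P

/-- The composite of a string of cells with a cell, for cells with identity frames. -/
abbrev gcomp {a b : D} {Q P : 𝔻.Path a b} {B : 𝔻.Pro a b} (Ψ : 𝔻.Cells Q P (𝟙 a) (𝟙 b))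
    (φ : 𝔻.Cell P (𝟙 a) (𝟙 b) B) : 𝔻.Cell Q (𝟙 a) (𝟙 b) B :=
  𝔻.comp Ψ φ (Category.comp_id _) (Category.comp_id _)

theorem isVComp_single {a b c d x y : D} {R : 𝔻.Path a b} {Q : 𝔻.Path c d} {A : 𝔻.Pro x y}
    {h : a ⟶ c} {k : b ⟶ d} {f : c ⟶ x} {g : d ⟶ y} {f' : a ⟶ x} {g' : b ⟶ y}
    (Θ : 𝔻.Cells R Q h k) (ψ : 𝔻.Cell Q f g A) (hf : h ≫ f = f') (hg : k ≫ g = g') :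
    CellPath.IsVComp 𝔻.comp Θ (.single ψ) (.single (𝔻.comp Θ ψ hf hg)) := by
  have key : ∀ {R' : 𝔻.Path a b} {Q' : 𝔻.Path c d} (Θ' : 𝔻.Cells R' Q' h k)
      (Ψ : 𝔻.Cells Q' (.single A) f g) (Ξ : 𝔻.Cells R' (.single A) f' g'),
      R' = R → Q' = Q → HEq Θ' Θ → HEq Ψ (CellPath.single ψ) →
      HEq Ξ (CellPath.single (𝔻.comp Θ ψ hf hg)) → CellPath.IsVComp 𝔻.comp Θ' Ψ Ξ →
      CellPath.IsVComp 𝔻.comp Θ (.single ψ) (.single (𝔻.comp Θ ψ hf hg)) := by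
    rintro R' Q' Θ' Ψ Ξ rfl rfl hΘ hΨ hΞ H
    cases hΘ
    cases hΨ
    cases hΞ
    exact H
  refine key _ _ _ (ProPath.append_nil _) (ProPath.append_nil _) (CellPath.append_nil_heq Θ) ?_ ?_
    (CellPath.IsVComp.cons Θ (.nil k) ψ (.nil g) (.nil g') hf hg (.nil k g g' hg))
  · exact CellPath.cons_heq _ _ _ _ _ rfl rfl HEq.rfl
  · exact CellPath.cons_heq _ _ _ _ _ rfl rfl HEq.rfl

theorem gassoc_single {a b : D} {R Q : 𝔻.Path a b} {A B : 𝔻.Pro a b}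
    (Θ : 𝔻.Cells R Q (𝟙 a) (𝟙 b)) (ψ : 𝔻.Cell Q (𝟙 a) (𝟙 b) A)
    (φ : 𝔻.Cell (.single A) (𝟙 a) (𝟙 b) B) :
    gcomp Θ (gcomp (.single ψ) φ) = gcomp (.single (gcomp Θ ψ)) φ :=
  𝔻.assoc _ _ _ _ _ _ _ _ _ _ (isVComp_single _ _ _ _)

theorem gassoc_pair {a b c : D} {R₁ Q₁ : 𝔻.Path a b} {R₂ Q₂ : 𝔻.Path b c} {A : 𝔻.Pro a b}
    {B : 𝔻.Pro b c} {C : 𝔻.Pro a c} (Θ₁ : 𝔻.Cells R₁ Q₁ (𝟙 a) (𝟙 b))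
    (Θ₂ : 𝔻.Cells R₂ Q₂ (𝟙 b) (𝟙 c)) (ψ₁ : 𝔻.Cell Q₁ (𝟙 a) (𝟙 b) A)
    (ψ₂ : 𝔻.Cell Q₂ (𝟙 b) (𝟙 c) B) (φ : 𝔻.Cell (.pair A B) (𝟙 a) (𝟙 c) C) :
    gcomp (Θ₁.append Θ₂) (gcomp (.pair ψ₁ ψ₂) φ) =
      gcomp (.pair (gcomp Θ₁ ψ₁) (gcomp Θ₂ ψ₂)) φ :=
  𝔻.assoc _ _ _ _ _ _ _ _ _ _
    (CellPath.IsVComp.cons Θ₁ Θ₂ ψ₁ _ _ _ _ (isVComp_single _ _ _ _))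

theorem gcomp_ids {a b : D} {P : 𝔻.Path a b} {B : 𝔻.Pro a b} (φ : 𝔻.Cell P (𝟙 a) (𝟙 b) B) :
    gcomp (idCells P) φ = φ :=
  𝔻.ids_comp φ

theorem gcomp_idCell {a b : D} {P : 𝔻.Path a b} {B : 𝔻.Pro a b} (φ : 𝔻.Cell P (𝟙 a) (𝟙 b) B) :
    gcomp (.single φ) (𝔻.idCell B) = φ :=
  𝔻.comp_id φ

/-- A cell `φ : P₁, …, Pₙ → Q` with identity frames is opcartesian if composition with it is a
bijection from the cells `R₁, …, Rₘ, Q, S₁, …, Sₖ → T` to the cells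
`R₁, …, Rₘ, P₁, …, Pₙ, S₁, …, Sₖ → T`, for all frames. -/
def IsOpcartesian {c d : D} {P : 𝔻.Path c d} {Q : 𝔻.Pro c d}
    (φ : 𝔻.Cell P (𝟙 c) (𝟙 d) Q) : Prop :=
  ∀ {a b x y : D} (R : 𝔻.Path a c) (S : 𝔻.Path d b) (f : a ⟶ x) (g : b ⟶ y) (T : 𝔻.Pro x y),
    Function.Bijective (fun ψ : 𝔻.Cell (R.append (.cons Q S)) f g T =>
      (𝔻.comp ((idCells R).append (.cons φ (idCells S) rfl)) ψ (Category.id_comp f)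
        (Category.id_comp g) : 𝔻.Cell (R.append (P.append S)) f g T))

/-- A cell `φ : P → Q` with frames `f` and `g` is cartesian if composition with it is a bijection
from the cells `R₁, …, Rₙ → P` with frames `h`, `k` to the cells `R₁, …, Rₙ → Q` with frames
`h ≫ f`, `k ≫ g`. -/
def IsCartesian {a b c d : D} {P : 𝔻.Pro a b} {Q : 𝔻.Pro c d} {f : a ⟶ c} {g : b ⟶ d}
    (φ : 𝔻.Cell (.single P) f g Q) : Prop :=
  ∀ {x y : D} (R : 𝔻.Path x y) (h : x ⟶ a) (k : y ⟶ b),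
    Function.Bijective (fun ψ : 𝔻.Cell R h k P =>
      (𝔻.comp (.single ψ) φ rfl rfl : 𝔻.Cell R (h ≫ f) (k ≫ g) Q))

variable (𝔻)

/-- Every string of `n ≥ 0` composable proarrows has a composite. -/
def HasComposites : Prop :=
  ∀ {a b : D} (P : 𝔻.Path a b), ∃ (Q : 𝔻.Pro a b) (φ : 𝔻.Cell P (𝟙 a) (𝟙 b) Q), IsOpcartesian φ

/-- All restrictions exist. -/
def HasRestrictions : Prop :=
  ∀ {a b c d : D} (f : a ⟶ c) (g : b ⟶ d) (Q : 𝔻.Pro c d),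
    ∃ (P : 𝔻.Pro a b) (φ : 𝔻.Cell (.single P) f g Q), IsCartesian φ

/-- A monoid in a virtual double category. -/
structure VMonoid (c : D) where
  pro : 𝔻.Pro c c
  e : 𝔻.Cell (.nil c) (𝟙 c) (𝟙 c) pro
  m : 𝔻.Cell (.pair pro pro) (𝟙 c) (𝟙 c) pro
  unit_mul : gcomp (.pair e (𝔻.idCell pro)) m = 𝔻.idCell pro
  mul_unit : gcomp (.pair (𝔻.idCell pro) e) m = 𝔻.idCell pro
  mul_assoc : gcomp (.pair m (𝔻.idCell pro)) m = gcomp (.pair (𝔻.idCell pro) m) m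

variable {𝔻}

/-- A monoid homomorphism. -/
@[ext] structure VMonoidHom {c d : D} (M : 𝔻.VMonoid c) (N : 𝔻.VMonoid d) where
  hom : c ⟶ d
  cell : 𝔻.Cell (.single M.pro) hom hom N.pro
  unit : 𝔻.comp (.single M.e) cell (Category.id_comp hom) (Category.id_comp hom) =
    𝔻.comp (.nil hom) N.e (Category.comp_id hom) (Category.comp_id hom)
  mul : 𝔻.comp (.single M.m) cell (Category.id_comp hom) (Category.id_comp hom) =
    𝔻.comp (.pair cell cell) N.m (Category.comp_id hom) (Category.comp_id hom)

/-- An `(M, N)`-bimodule. -/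
structure VBimodule {c d : D} (M : 𝔻.VMonoid c) (N : 𝔻.VMonoid d) where
  pro : 𝔻.Pro c d
  l : 𝔻.Cell (.pair M.pro pro) (𝟙 c) (𝟙 d) pro
  r : 𝔻.Cell (.pair pro N.pro) (𝟙 c) (𝟙 d) pro
  unit_l : gcomp (.pair M.e (𝔻.idCell pro)) l = 𝔻.idCell pro
  mul_l : gcomp (.pair M.m (𝔻.idCell pro)) l = gcomp (.pair (𝔻.idCell M.pro) l) l
  unit_r : gcomp (.pair (𝔻.idCell pro) N.e) r = 𝔻.idCell pro
  mul_r : gcomp (.pair (𝔻.idCell pro) N.m) r = gcomp (.pair r (𝔻.idCell N.pro)) r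
  l_r : gcomp (.pair l (𝔻.idCell N.pro)) r = gcomp (.pair (𝔻.idCell M.pro) r) l

/-- The unit `(M, M)`-bimodule: `M` acting on itself on both sides. -/
def VMonoid.unitBimodule {c : D} (M : 𝔻.VMonoid c) : VBimodule M M where
  pro := M.pro
  l := M.m
  r := M.m
  unit_l := M.unit_mul
  mul_l := M.mul_assoc
  unit_r := M.mul_unit
  mul_r := M.mul_assoc.symm
  l_r := M.mul_assoc

/-- The cell `φ : B → B'` whose frames are the vertical arrows of the monoid homomorphisms `F`
and `G` is a bimodule homomorphism over `F` and `G`. -/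
structure IsBimoduleHom {c d c' d' : D} {M : 𝔻.VMonoid c} {N : 𝔻.VMonoid d} {M' : 𝔻.VMonoid c'} {N' : 𝔻.VMonoid d'}
    (F : VMonoidHom M M') (G : VMonoidHom N N') (B : VBimodule M N) (B' : VBimodule M' N')
    (φ : 𝔻.Cell (.single B.pro) F.hom G.hom B'.pro) : Prop where
  left : 𝔻.comp (.single B.l) φ (Category.id_comp _) (Category.id_comp _) =
    𝔻.comp (.pair F.cell φ) B'.l (Category.comp_id _) (Category.comp_id _)
  right : 𝔻.comp (.single B.r) φ (Category.id_comp _) (Category.id_comp _) =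
    𝔻.comp (.pair φ G.cell) B'.r (Category.comp_id _) (Category.comp_id _)

end VirtualDoubleCategory

/-! ### Virtual equipments -/

open VirtualDoubleCategory

/-- A virtual equipment: a virtual double category with (chosen) units and with restrictions. -/
structure VirtualEquipment (D : Type u) [Category.{v} D] extends
    VirtualDoubleCategory.{w, w'} D where
  U : ∀ c : D, Pro c c
  η : ∀ c : D, Cell (.nil c) (𝟙 c) (𝟙 c) (U c)
  η_opcartesian : ∀ c : D, toVirtualDoubleCategory.IsOpcartesian (η c)
  hasRestrictions : toVirtualDoubleCategory.HasRestrictions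

namespace VirtualEquipment

variable {D : Type u} [Category.{v} D] (𝔼 : VirtualEquipment.{w, w'} D)

/-- The canonical cell `U, P → P`. -/
noncomputable def lam {a b : D} (P : 𝔼.Pro a b) : 𝔼.Cell (.pair (𝔼.U a) P) (𝟙 a) (𝟙 b) P :=
  ((𝔼.η_opcartesian a (.nil a) (.single P) (𝟙 a) (𝟙 b) P).2 (𝔼.idCell P)).choose

theorem lam_spec {a b : D} (P : 𝔼.Pro a b) :
    gcomp (.pair (𝔼.η a) (𝔼.idCell P)) (𝔼.lam P) = 𝔼.idCell P :=
  ((𝔼.η_opcartesian a (.nil a) (.single P) (𝟙 a) (𝟙 b) P).2 (𝔼.idCell P)).choose_spec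

/-- The canonical cell `P, U → P`. -/
noncomputable def rho {a b : D} (P : 𝔼.Pro a b) : 𝔼.Cell (.pair P (𝔼.U b)) (𝟙 a) (𝟙 b) P :=
  ((𝔼.η_opcartesian b (.single P) (.nil b) (𝟙 a) (𝟙 b) P).2 (𝔼.idCell P)).choose

theorem rho_spec {a b : D} (P : 𝔼.Pro a b) :
    gcomp (.pair (𝔼.idCell P) (𝔼.η b)) (𝔼.rho P) = 𝔼.idCell P :=
  ((𝔼.η_opcartesian b (.single P) (.nil b) (𝟙 a) (𝟙 b) P).2 (𝔼.idCell P)).choose_spec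

/-- The unit cell on a vertical arrow. -/
noncomputable def unitCell {c d : D} (f : c ⟶ d) : 𝔼.Cell (.single (𝔼.U c)) f f (𝔼.U d) :=
  ((𝔼.η_opcartesian c (.nil c) (.nil c) f f (𝔼.U d)).2
    (𝔼.comp (.nil f) (𝔼.η d) (Category.comp_id f) (Category.comp_id f))).choose

theorem unitCell_spec {c d : D} (f : c ⟶ d) :
    𝔼.comp (.single (𝔼.η c)) (𝔼.unitCell f) (Category.id_comp f) (Category.id_comp f) =
      𝔼.comp (.nil f) (𝔼.η d) (Category.comp_id f) (Category.comp_id f) :=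
  ((𝔼.η_opcartesian c (.nil c) (.nil c) f f (𝔼.U d)).2
    (𝔼.comp (.nil f) (𝔼.η d) (Category.comp_id f) (Category.comp_id f))).choose_spec

variable {𝔼} in
theorem eta_cancel {a b : D} {S : 𝔼.Path a b} {T : 𝔼.Pro a b}
    {φ ψ : 𝔼.Cell (.cons (𝔼.U a) S) (𝟙 a) (𝟙 b) T}
    (h : gcomp ((CellPath.single (𝔼.η a)).append (idCells S)) φ =
      gcomp ((CellPath.single (𝔼.η a)).append (idCells S)) ψ) : φ = ψ :=
  (𝔼.η_opcartesian a (.nil a) S (𝟙 a) (𝟙 b) T).1 h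

variable {𝔼} in
theorem eta_cancel_right {a b c : D} {P : 𝔼.Pro a b} {Q : 𝔼.Pro b c} {T : 𝔼.Pro a c}
    {φ ψ : 𝔼.Cell (.cons P (.pair Q (𝔼.U c))) (𝟙 a) (𝟙 c) T}
    (h : gcomp ((idCells (.pair P Q)).append (CellPath.single (𝔼.η c))) φ =
      gcomp ((idCells (.pair P Q)).append (CellPath.single (𝔼.η c))) ψ) : φ = ψ :=
  (𝔼.η_opcartesian c (.pair P Q) (.nil c) (𝟙 a) (𝟙 c) T).1 h

theorem eta_lam {a b : D} {S : 𝔼.Path a b} {P : 𝔼.Pro a b} (φ : 𝔼.Cell S (𝟙 a) (𝟙 b) P) :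
    gcomp (.pair (𝔼.η a) φ) (𝔼.lam P) = φ := by
  have h := gassoc_pair (CellPath.nil (𝟙 a)) (.single φ) (𝔼.η a) (𝔼.idCell P) (𝔼.lam P)
  rw [lam_spec, gcomp_idCell] at h
  have h' : gcomp (CellPath.nil (𝟙 a)) (𝔼.η a) = 𝔼.η a := gcomp_ids (𝔼.η a)
  rw [h'] at h
  exact h.symm.trans (gcomp_idCell φ)

theorem lam_lam {a b : D} (P : 𝔼.Pro a b) :
    gcomp (.pair (𝔼.lam (𝔼.U a)) (𝔼.idCell P)) (𝔼.lam P) =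
      gcomp (.pair (𝔼.idCell (𝔼.U a)) (𝔼.lam P)) (𝔼.lam P) := by
  apply eta_cancel
  have h₁ := gassoc_pair (.pair (𝔼.η a) (𝔼.idCell (𝔼.U a))) (.single (𝔼.idCell P))
    (𝔼.lam (𝔼.U a)) (𝔼.idCell P) (𝔼.lam P)
  rw [lam_spec, gcomp_idCell] at h₁
  have h₂ := gassoc_pair (.single (𝔼.η a)) (idCells (.pair (𝔼.U a) P))
    (𝔼.idCell (𝔼.U a)) (𝔼.lam P) (𝔼.lam P)
  rw [gcomp_idCell, gcomp_ids, eta_lam] at h₂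
  exact (h₁.trans (gcomp_ids (𝔼.lam P))).trans h₂.symm

theorem lam_unit (a : D) :
    gcomp (.pair (𝔼.idCell (𝔼.U a)) (𝔼.η a)) (𝔼.lam (𝔼.U a)) = 𝔼.idCell (𝔼.U a) := by
  apply eta_cancel
  have h := gassoc_pair (.single (𝔼.η a)) (.nil (𝟙 a)) (𝔼.idCell (𝔼.U a)) (𝔼.η a)
    (𝔼.lam (𝔼.U a))
  have h' : gcomp (CellPath.nil (𝟙 a)) (𝔼.η a) = 𝔼.η a := gcomp_ids (𝔼.η a)
  rw [gcomp_idCell, h', eta_lam] at h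
  exact h.trans (gcomp_idCell (𝔼.η a)).symm

theorem rho_rho {a b : D} (P : 𝔼.Pro a b) :
    gcomp (.pair (𝔼.idCell P) (𝔼.lam (𝔼.U b))) (𝔼.rho P) =
      gcomp (.pair (𝔼.rho P) (𝔼.idCell (𝔼.U b))) (𝔼.rho P) := by
  apply eta_cancel_right
  have h₁ := gassoc_pair (.single (𝔼.idCell P)) (.pair (𝔼.idCell (𝔼.U b)) (𝔼.η b))
    (𝔼.idCell P) (𝔼.lam (𝔼.U b)) (𝔼.rho P)
  rw [lam_unit, gcomp_idCell] at h₁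
  have h₂ := gassoc_pair (idCells (.pair P (𝔼.U b))) (.single (𝔼.η b))
    (𝔼.rho P) (𝔼.idCell (𝔼.U b)) (𝔼.rho P)
  rw [gcomp_idCell, gcomp_ids] at h₂
  have h₃ := gassoc_pair (.single (𝔼.rho P)) (.nil (𝟙 b)) (𝔼.idCell P) (𝔼.η b) (𝔼.rho P)
  have h' : gcomp (CellPath.nil (𝟙 b)) (𝔼.η b) = 𝔼.η b := gcomp_ids (𝔼.η b)
  rw [rho_spec, gcomp_idCell, h'] at h₃
  have h₄ := h₃.symm.trans (gcomp_idCell (𝔼.rho P))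
  exact (h₁.trans (gcomp_ids (𝔼.rho P))).trans (h₂.trans h₄).symm

theorem lam_rho {a b : D} (P : 𝔼.Pro a b) :
    gcomp (.pair (𝔼.lam P) (𝔼.idCell (𝔼.U b))) (𝔼.rho P) =
      gcomp (.pair (𝔼.idCell (𝔼.U a)) (𝔼.rho P)) (𝔼.lam P) := by
  apply eta_cancel
  have h₁ := gassoc_pair (.pair (𝔼.η a) (𝔼.idCell P)) (.single (𝔼.idCell (𝔼.U b)))
    (𝔼.lam P) (𝔼.idCell (𝔼.U b)) (𝔼.rho P)
  rw [lam_spec, gcomp_idCell] at h₁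
  have h₂ := gassoc_pair (.single (𝔼.η a)) (idCells (.pair P (𝔼.U b)))
    (𝔼.idCell (𝔼.U a)) (𝔼.rho P) (𝔼.lam P)
  rw [gcomp_idCell, gcomp_ids, eta_lam] at h₂
  exact (h₁.trans (gcomp_ids (𝔼.rho P))).trans h₂.symm

/-- The trivial monoid on an object: its unit proarrow. -/
noncomputable def trivialMonoid (x : D) : 𝔼.VMonoid x where
  pro := 𝔼.U x
  e := 𝔼.η x
  m := 𝔼.lam (𝔼.U x)
  unit_mul := 𝔼.lam_spec _
  mul_unit := 𝔼.lam_unit x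
  mul_assoc := 𝔼.lam_lam _

/-- A proarrow regarded as a bimodule between trivial monoids. -/
noncomputable def trivialBimodule {x y : D} (P : 𝔼.Pro x y) :
    VBimodule (𝔼.trivialMonoid x) (𝔼.trivialMonoid y) where
  pro := P
  l := 𝔼.lam P
  r := 𝔼.rho P
  unit_l := 𝔼.lam_spec P
  mul_l := 𝔼.lam_lam P
  unit_r := 𝔼.rho_spec P
  mul_r := 𝔼.rho_rho P
  l_r := 𝔼.lam_rho P

/-- An embedding of a monoid into an object `x`: a homomorphism to the trivial monoid on `x`. -/
abbrev Embedding {c : D} (M : 𝔼.VMonoid c) (x : D) := VMonoidHom M (𝔼.trivialMonoid x)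

variable {𝔼}

/-- `φ` is an embedding of the bimodule `B` into the proarrow `P`, over the embeddings `F` and `G`
of monoids. -/
abbrev IsBimoduleEmbedding {c d x y : D} {M : 𝔼.VMonoid c} {N : 𝔼.VMonoid d}
    (F : 𝔼.Embedding M x) (G : 𝔼.Embedding N y) (B : VBimodule M N) (P : 𝔼.Pro x y)
    (φ : 𝔼.Cell (.single B.pro) F.hom G.hom P) : Prop :=
  IsBimoduleHom F G B (𝔼.trivialBimodule P) φ

/-- The embedding `G` is the composite of the embedding `F` with the vertical arrow `f`, that is,
the cell of `G` is the cell of `F` followed by the unit cell on `f`. -/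
structure Factors {c x y : D} {M : 𝔼.VMonoid c} (F : 𝔼.Embedding M x) (f : x ⟶ y)
    (G : 𝔼.Embedding M y) : Prop where
  hom_eq : F.hom ≫ f = G.hom
  cell_eq : 𝔼.comp (.single F.cell) (𝔼.unitCell f) hom_eq hom_eq = G.cell

/-- A collapse of a monoid: a universal embedding. -/
def IsCollapse {c x : D} {M : 𝔼.VMonoid c} (F : 𝔼.Embedding M x) : Prop :=
  ∀ {y : D} (G : 𝔼.Embedding M y), ∃! f : x ⟶ y, Factors F f G

/-- A collapse of a bimodule: a universal embedding over collapses `F` and `G` of its monoids. -/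
structure IsBimoduleCollapse {c d x y : D} {M : 𝔼.VMonoid c} {N : 𝔼.VMonoid d}
    (F : 𝔼.Embedding M x) (G : 𝔼.Embedding N y) (B : VBimodule M N) (P : 𝔼.Pro x y)
    (φ : 𝔼.Cell (.single B.pro) F.hom G.hom P) : Prop where
  left : IsCollapse F
  right : IsCollapse G
  embedding : IsBimoduleEmbedding F G B P φ
  universal : ∀ {x' y' : D} (F' : 𝔼.Embedding M x') (G' : 𝔼.Embedding N y') (Q : 𝔼.Pro x' y')
    (ψ : 𝔼.Cell (.single B.pro) F'.hom G'.hom Q), IsBimoduleEmbedding F' G' B Q ψ →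
    ∀ {f : x ⟶ x'} {g : y ⟶ y'} (hf : Factors F f F') (hg : Factors G g G'),
      ∃! χ : 𝔼.Cell (.single P) f g Q, 𝔼.comp (.single φ) χ hf.hom_eq hg.hom_eq = ψ

/-- A normal collapse: a collapse of `M` that is also a collapse of the unit bimodule of `M` into
the unit proarrow. -/
def IsNormalCollapse {c x : D} {M : 𝔼.VMonoid c} (F : 𝔼.Embedding M x) : Prop :=
  IsCollapse F ∧ IsBimoduleCollapse F F M.unitBimodule (𝔼.U x) F.cell

/-- The embedding `F` exhibits `M` as the kernel of the vertical arrow `F.hom`: the proarrow of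
`M` is the restriction of the unit proarrow along `F.hom` on both sides, and the monoid structure
is the one induced from the trivial monoid. -/
def IsKernelCell {c x : D} {M : 𝔼.VMonoid c} (F : 𝔼.Embedding M x) : Prop :=
  IsCartesian F.cell

/-- `M` is (isomorphic to) the kernel of the vertical arrow `f`. -/
def IsKernel {c x : D} (M : 𝔼.VMonoid c) (f : c ⟶ x) : Prop :=
  ∃ F : 𝔼.Embedding M x, F.hom = f ∧ IsKernelCell F

/-- A monoid is effective if it is the kernel of some vertical arrow. -/
def IsEffective {c : D} (M : 𝔼.VMonoid c) : Prop :=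
  ∃ (x : D) (f : c ⟶ x), IsKernel M f

variable (𝔼) in
/-- A vertical arrow is a regular cover if its kernel cell is a normal collapse. -/
def IsRegularCover {c d : D} (f : c ⟶ d) : Prop :=
  ∃ (M : 𝔼.VMonoid c) (F : 𝔼.Embedding M d), F.hom = f ∧ IsKernelCell F ∧ IsNormalCollapse F

variable (𝔼) in
/-- Regular virtual equipments. In the second axiom `φ` is any cartesian embedding
`B(g, f) → B`, where `f` and `g` are the vertical arrows of `F` and `G`. -/
structure IsRegular : Prop where
  exists_normalCollapse : ∀ {c : D} (M : 𝔼.VMonoid c), IsEffective M →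
    ∃ (x : D) (F : 𝔼.Embedding M x), IsNormalCollapse F
  isBimoduleCollapse : ∀ {c c' d d' : D} (B : 𝔼.Pro d d') {M : 𝔼.VMonoid c} {N : 𝔼.VMonoid c'}
    (F : 𝔼.Embedding M d) (G : 𝔼.Embedding N d'), IsKernelCell F → IsKernelCell G →
    𝔼.IsRegularCover F.hom → 𝔼.IsRegularCover G.hom →
    ∀ (A : VBimodule M N) (φ : 𝔼.Cell (.single A.pro) F.hom G.hom B),
      IsBimoduleEmbedding F G A B φ → IsCartesian φ → IsBimoduleCollapse F G A B φ

end VirtualEquipment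

/-! ### Internal relations -/

namespace InternalRel

variable {C : Type u} [Category.{v} C] [HasFiniteLimits C]

/-- Relations `R : a ⇸ b`, i.e. monomorphisms `R ↪ b × a`. -/
abbrev Relation (a b : C) := MonoOver (b ⨯ a)

/-- The leg of a relation `R : a ⇸ b` to its source `a`. -/
noncomputable abbrev src {a b : C} (R : Relation a b) : (R : C) ⟶ a := R.arrow ≫ prod.snd

/-- The leg of a relation `R : a ⇸ b` to its target `b`. -/
noncomputable abbrev tgt {a b : C} (R : Relation a b) : (R : C) ⟶ b := R.arrow ≫ prod.fst

/-- A span from `a` to `b`. -/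
structure Sp (a b : C) where
  apex : C
  l : apex ⟶ a
  r : apex ⟶ b

/-- The identity span. -/
abbrev Sp.id (a : C) : Sp a a := ⟨a, 𝟙 a, 𝟙 a⟩

/-- A relation as a span. -/
noncomputable abbrev Sp.ofRel {a b : C} (R : Relation a b) : Sp a b := ⟨R, src R, tgt R⟩

/-- The composite of spans, formed by pullback. -/
noncomputable abbrev Sp.comp {a b c : C} (S : Sp a b) (T : Sp b c) : Sp a c :=
  ⟨pullback S.r T.l, pullback.fst _ _ ≫ S.l, pullback.snd _ _ ≫ T.r⟩

/-- Morphisms of spans over `h` and `k`. -/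
@[ext] structure SpHom {a b c d : C} (S : Sp a b) (T : Sp c d) (h : a ⟶ c) (k : b ⟶ d) where
  map : S.apex ⟶ T.apex
  map_l : map ≫ T.l = S.l ≫ h
  map_r : map ≫ T.r = S.r ≫ k

/-- A cone with legs to `S` and `T`, agreeing over the middle object. -/
structure SpProj {a b c : C} (X : Sp a c) (S : Sp a b) (T : Sp b c) where
  p : X.apex ⟶ S.apex
  q : X.apex ⟶ T.apex
  p_l : p ≫ S.l = X.l
  q_r : q ≫ T.r = X.r
  mid : p ≫ S.r = q ≫ T.l

/-- The case of an identity span. -/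
def SpProj.id {a c : C} (T : Sp a c) : SpProj T (Sp.id a) T where
  p := T.l
  q := 𝟙 _
  p_l := by simp
  q_r := by simp
  mid := by simp

/-- Composing a cone with a span on the left. -/
noncomputable def SpProj.cons {z a b c : C} (R : Sp z a) {X : Sp a c} {S : Sp a b} {T : Sp b c}
    (π : SpProj X S T) : SpProj (R.comp X) (R.comp S) T where
  p := pullback.lift (pullback.fst _ _) (pullback.snd _ _ ≫ π.p)
    (by rw [Category.assoc, π.p_l, pullback.condition])
  q := pullback.snd _ _ ≫ π.q
  p_l := by simp [pullback.lift_fst_assoc]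
  q_r := by simp [π.q_r]
  mid := by simp [π.mid, pullback.lift_snd_assoc]

/-- The morphism into a composite of spans induced by morphisms into the two spans. -/
noncomputable def SpHom.pair {a b e c d i : C} {X : Sp a e} {S : Sp a b} {T : Sp b e}
    {S' : Sp c d} {T' : Sp d i} {h : a ⟶ c} {k : b ⟶ d} {l : e ⟶ i} (π : SpProj X S T)
    (m : SpHom S S' h k) (n : SpHom T T' k l) : SpHom X (S'.comp T') h l where
  map := pullback.lift (π.p ≫ m.map) (π.q ≫ n.map)
    (by rw [Category.assoc, Category.assoc, m.map_r, n.map_l, reassoc_of% π.mid])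
  map_l := by simp [pullback.lift_fst_assoc, m.map_l, reassoc_of% π.p_l]
  map_r := by simp [pullback.lift_snd_assoc, n.map_r, reassoc_of% π.q_r]

/-- The span composite `R₁ ×_{c₁} R₂ ×_{c₂} ⋯ ×_{cₙ₋₁} Rₙ` of a string of relations. For the empty
string on `a` it is `a` with two identity legs. -/
noncomputable def span : {a b : C} → ProPath (Relation (C := C)) a b → Sp a b
  | _, _, .nil a => Sp.id a
  | _, _, .cons R P => (Sp.ofRel R).comp (span P)

/-- Cells `R₁, …, Rₙ → S` with frames `f` and `g`: morphisms from the span composite of the `Rᵢ` to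
`S` that form a commutative square with `g × f`. -/
@[ext] structure RelCell {a b c d : C} (P : ProPath (Relation (C := C)) a b) (f : a ⟶ c)
    (g : b ⟶ d) (S : Relation c d) where
  map : (span P).apex ⟶ (S : C)
  w : map ≫ S.arrow = prod.lift (span P).r (span P).l ≫ prod.map g f

instance {a b c d : C} (P : ProPath (Relation (C := C)) a b) (f : a ⟶ c) (g : b ⟶ d)
    (S : Relation c d) : Subsingleton (RelCell P f g S) :=
  ⟨fun φ ψ => RelCell.ext ((cancel_mono S.arrow).1 (φ.w.trans ψ.w.symm))⟩

/-- A cell as a morphism of spans. -/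
noncomputable def RelCell.toSpHom {a b c d : C} {P : ProPath (Relation (C := C)) a b} {f : a ⟶ c}
    {g : b ⟶ d} {S : Relation c d} (φ : RelCell P f g S) : SpHom (span P) (Sp.ofRel S) f g where
  map := φ.map
  map_l := by simp [reassoc_of% φ.w, prod.lift_snd_assoc]
  map_r := by simp [reassoc_of% φ.w, prod.lift_fst_assoc]

variable (C) in
/-- Relations and their cells. -/
noncomputable def graph : VirtualDoubleGraph.{max u v, v} C where
  Pro := Relation
  Cell := RelCell

/-- The span composite of a concatenation projects to both span composites. -/
noncomputable def appendProj : {a b c : C} → (P : ProPath (Relation (C := C)) a b) →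
    (Q : ProPath (Relation (C := C)) b c) → SpProj (span (P.append Q)) (span P) (span Q)
  | _, _, _, .nil _, Q => SpProj.id (span Q)
  | _, _, _, .cons R P, Q => SpProj.cons (Sp.ofRel R) (appendProj P Q)

/-- The morphism of span composites induced by a string of cells. -/
noncomputable def cellsMap {a b c d : C} {Q : ProPath (Relation (C := C)) a b}
    {P : ProPath (Relation (C := C)) c d} {h : a ⟶ c} {k : b ⟶ d} :
    CellPath (graph C) Q P h k → SpHom (span Q) (span P) h k
  | .nil h => ⟨h, (Category.comp_id _).trans (Category.id_comp _).symm,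
      (Category.comp_id _).trans (Category.id_comp _).symm⟩
  | .cons (Q := Q₁) (Q' := Q₂) ψ Ψ hR =>
      SpHom.pair (hR ▸ appendProj Q₁ Q₂) (RelCell.toSpHom ψ) (cellsMap Ψ)

/-- The identity cell of a relation. -/
noncomputable def idRelCell {a b : C} (A : Relation a b) :
    RelCell (.single A) (𝟙 a) (𝟙 b) A where
  map := (pullback.fst (tgt A) (𝟙 b) :)
  w := by
    dsimp only [span]
    ext
    · simpa [prod.lift_fst] using pullback.condition (f := tgt A) (g := 𝟙 _)
    · simp [prod.lift_snd]

/-- The composite of a morphism of span composites with a cell. -/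
noncomputable def RelCell.precomp {a b c d x y : C} {Q : ProPath (Relation (C := C)) a b}
    {P : ProPath (Relation (C := C)) c d} {B : Relation x y} {h : a ⟶ c} {k : b ⟶ d} {f : c ⟶ x}
    {g : d ⟶ y} {f' : a ⟶ x} {g' : b ⟶ y} (m : SpHom (span Q) (span P) h k)
    (φ : RelCell P f g B) (hf : h ≫ f = f') (hg : k ≫ g = g') : RelCell Q f' g' B where
  map := m.map ≫ φ.map
  w := by
    subst hf hg
    rw [Category.assoc, φ.w]
    ext
    · simp [reassoc_of% m.map_r, prod.lift_fst]
    · simp [reassoc_of% m.map_l, prod.lift_snd]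

variable (C) in
/-- The virtual double category of internal relations. -/
noncomputable def Rel : VirtualDoubleCategory.{max u v, v} C where
  toVirtualDoubleGraph := graph C
  idCell A := idRelCell A
  comp Ψ φ hf hg := RelCell.precomp (cellsMap Ψ) φ hf hg
  ids_comp _ := Subsingleton.elim (α := RelCell _ _ _ _) _ _
  comp_id _ := Subsingleton.elim (α := RelCell _ _ _ _) _ _
  assoc _ _ _ _ _ _ _ _ _ _ _ := Subsingleton.elim (α := RelCell _ _ _ _) _ _

/-- The unit relation on `a`: the diagonal `a ↪ a × a`. -/
noncomputable def diagRel (a : C) : Relation a a := MonoOver.mk (diag a)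

theorem src_diagRel (a : C) : src (diagRel a) = tgt (diagRel a) :=
  (prod.lift_snd (𝟙 a) (𝟙 a)).trans (prod.lift_fst (𝟙 a) (𝟙 a)).symm

/-- The cell from the empty string to the diagonal. -/
noncomputable def diagCell (a : C) : RelCell (.nil a) (𝟙 a) (𝟙 a) (diagRel a) where
  map := 𝟙 a
  w := by
    refine (Category.id_comp (diag a)).trans ?_
    dsimp only [span]
    simp

/-- A diagonal can be removed from a string of relations. -/
noncomputable def removeDiag {b d : C} (S : ProPath (Relation (C := C)) b d) :
    {a : C} → (R : ProPath (Relation (C := C)) a b) →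
      SpHom (span (R.append (.cons (diagRel b) S))) (span (R.append S)) (𝟙 a) (𝟙 d)
  | _, .nil _ =>
    { map := (pullback.snd (tgt (diagRel b)) (span S).l :)
      map_l := by
        change pullback.snd (tgt (diagRel b)) (span S).l ≫ (span S).l =
          (pullback.fst (tgt (diagRel b)) (span S).l ≫ src (diagRel b)) ≫ 𝟙 _
        rw [← pullback.condition, src_diagRel, Category.comp_id]
      map_r := (Category.comp_id _).symm }
  | _, .cons A R =>
    { map := (pullback.lift (pullback.fst _ _) (pullback.snd _ _ ≫ (removeDiag S R).map) (by
          rw [Category.assoc, (removeDiag S R).map_l, Category.comp_id, pullback.condition]) :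
          ((Sp.ofRel A).comp (span (R.append (.cons (diagRel b) S)))).apex ⟶
            ((Sp.ofRel A).comp (span (R.append S))).apex)
      map_l := by
        dsimp only [ProPath.append, span]
        simp [pullback.lift_fst_assoc]
      map_r := by
        dsimp only [ProPath.append, span]
        simp [pullback.lift_snd_assoc, (removeDiag S R).map_r] }

theorem diagCell_isOpcartesian (a : C) : (Rel C).IsOpcartesian (diagCell a) := fun R S f g T =>
  ⟨fun _ _ _ => Subsingleton.elim (α := RelCell _ _ _ _) _ _, fun ψ =>
    ⟨RelCell.precomp (P := ProPath.append R S) (B := T) (removeDiag S R) ψ (Category.id_comp f)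
      (Category.id_comp g), Subsingleton.elim (α := RelCell _ _ _ _) _ _⟩⟩

/-- The restriction of a relation: its pullback along `g × f`. -/
noncomputable def restr {a b c d : C} (f : a ⟶ c) (g : b ⟶ d) (Q : Relation c d) :
    Relation a b :=
  MonoOver.mk (pullback.snd Q.arrow (prod.map g f))

/-- The projection of a restriction. -/
noncomputable def restrMap {a b c d : C} (f : a ⟶ c) (g : b ⟶ d) (Q : Relation c d) :
    (restr f g Q : C) ⟶ (Q : C) :=
  pullback.fst Q.arrow (prod.map g f)

theorem restrMap_w {a b c d : C} (f : a ⟶ c) (g : b ⟶ d) (Q : Relation c d) :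
    restrMap f g Q ≫ Q.arrow = (restr f g Q).arrow ≫ prod.map g f :=
  pullback.condition

/-- The restriction cell. -/
noncomputable def restrCell {a b c d : C} (f : a ⟶ c) (g : b ⟶ d) (Q : Relation c d) :
    RelCell (.single (restr f g Q)) f g Q where
  map := (idRelCell (restr f g Q)).map ≫ restrMap f g Q
  w := by
    have h := (idRelCell (restr f g Q)).w
    rw [prod.map_id_id, Category.comp_id] at h
    rw [← h, Category.assoc, Category.assoc, restrMap_w]

/-- The factorization of a cell through the restriction cell. -/
noncomputable def restrLift {x y a b c d : C} {f : a ⟶ c} {g : b ⟶ d} {Q : Relation c d}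
    {R : ProPath (Relation (C := C)) x y} {h : x ⟶ a} {k : y ⟶ b}
    (ψ : RelCell R (h ≫ f) (k ≫ g) Q) : RelCell R h k (restr f g Q) where
  map := (pullback.lift (f := Q.arrow) (g := prod.map g f) ψ.map (prod.lift (span R).r (span R).l ≫ prod.map k h)
    (by rw [ψ.w]; simp) :)
  w := pullback.lift_snd _ _ _

theorem rel_hasRestrictions : (Rel C).HasRestrictions := fun f g Q =>
  ⟨restr f g Q, restrCell f g Q, fun _ _ _ =>
    ⟨fun _ _ _ => Subsingleton.elim (α := RelCell _ _ _ _) _ _, fun ψ =>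
      ⟨restrLift ψ, Subsingleton.elim (α := RelCell _ _ _ _) _ _⟩⟩⟩

variable (C) in
/-- The virtual equipment of internal relations, with the diagonals as units. -/
noncomputable def RelEquipment : VirtualEquipment.{max u v, v} C where
  toVirtualDoubleCategory := Rel C
  U := diagRel
  η := diagCell
  η_opcartesian := diagCell_isOpcartesian
  hasRestrictions := rel_hasRestrictions

/-- The underlying relation `R ↪ a × a` of a monoid in `RelEquipment C`. -/
abbrev monRel {a : C} (M : (RelEquipment C).VMonoid a) : Relation a a := M.pro

end InternalRel

/-!
A cell of relations is a factorization through a monomorphism, so there is at most one cell with a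
given boundary: every equation between cells holds, and the universal properties reduce to the
existence of factorizations.

The unit on `x` is the diagonal, so a cell from a relation `R` to it with frames `f` and `g` exists
precisely when the legs of `R` satisfy `tgt R ≫ g = src R ≫ f`. Hence the kernel of `f`, the
restriction of the diagonal along `f × f`, is the kernel pair of `f`, and a collapse of a monoid is
a coequalizer of its two projections. Such a coequalizer `q` is a regular epimorphism, and regular
epimorphisms are orthogonal to monomorphisms. Hence a bimodule embedding of `M`, precomposed with
the unit of `M`, descends along `q` to a cell from the diagonal: every collapse is normal.

When regular epimorphisms are stable under pullback, replacing a string of relations by the image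
of its span composite changes any longer string only up to a regular epimorphism, which relations
cannot detect, so images are composites. Likewise a restriction `B(g, f)` along regular covers maps
to `B` by a pullback of the regular epimorphism `g × f`, so cells out of it descend to `B`.
-/

namespace VirtualDoubleCategory

variable {D : Type u} [Category.{v} D] {𝔻 : VirtualDoubleCategory.{w, w'} D}

variable (𝔻) in
/-- A virtual double category is flat if there is at most one cell with a given boundary, so that
all equations between cells hold and only the existence of cells matters. -/
class IsFlat : Prop where
  subsingleton_cell {a b c d : D} (P : 𝔻.Path a b) (f : a ⟶ c) (g : b ⟶ d) (Q : 𝔻.Pro c d) :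
    Subsingleton (𝔻.Cell P f g Q)

attribute [instance] IsFlat.subsingleton_cell

variable [𝔻.IsFlat]

theorem isOpcartesian_iff_nonempty {c d : D} {P : 𝔻.Path c d} {Q : 𝔻.Pro c d}
    (φ : 𝔻.Cell P (𝟙 c) (𝟙 d) Q) :
    𝔻.IsOpcartesian φ ↔ ∀ {a b x y : D} (R : 𝔻.Path a c) (S : 𝔻.Path d b) (f : a ⟶ x) (g : b ⟶ y)
      (T : 𝔻.Pro x y), Nonempty (𝔻.Cell (R.append (P.append S)) f g T) →
        Nonempty (𝔻.Cell (R.append (.cons Q S)) f g T) :=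
  ⟨fun h _ _ _ _ R S f g T ⟨ψ⟩ => ⟨((h R S f g T).2 ψ).choose⟩,
    fun h _ _ _ _ R S f g T => ⟨Function.injective_of_subsingleton _,
      fun ψ => ⟨(h R S f g T ⟨ψ⟩).some, Subsingleton.elim _ _⟩⟩⟩

theorem isCartesian_iff_nonempty {a b c d : D} {P : 𝔻.Pro a b} {Q : 𝔻.Pro c d} {f : a ⟶ c}
    {g : b ⟶ d} (φ : 𝔻.Cell (.single P) f g Q) :
    𝔻.IsCartesian φ ↔ ∀ {x y : D} (R : 𝔻.Path x y) (h : x ⟶ a) (k : y ⟶ b),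
      Nonempty (𝔻.Cell R (h ≫ f) (k ≫ g) Q) → Nonempty (𝔻.Cell R h k P) :=
  ⟨fun H _ _ R h k ⟨ψ⟩ => ⟨((H R h k).2 ψ).choose⟩,
    fun H _ _ R h k => ⟨Function.injective_of_subsingleton _,
      fun ψ => ⟨(H R h k ⟨ψ⟩).some, Subsingleton.elim _ _⟩⟩⟩

/-- In a flat virtual double category, a monoid is a proarrow with unit and multiplication cells. -/
def VMonoid.ofCells {c : D} (P : 𝔻.Pro c c) (e : 𝔻.Cell (.nil c) (𝟙 c) (𝟙 c) P)
    (m : 𝔻.Cell (.pair P P) (𝟙 c) (𝟙 c) P) : 𝔻.VMonoid c where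
  pro := P
  e := e
  m := m
  unit_mul := Subsingleton.elim _ _
  mul_unit := Subsingleton.elim _ _
  mul_assoc := Subsingleton.elim _ _

/-- In a flat virtual double category, every cell between monoids with equal left and right frames
is a monoid homomorphism. -/
def VMonoidHom.ofCell {c d : D} {M : 𝔻.VMonoid c} {N : 𝔻.VMonoid d} (f : c ⟶ d)
    (φ : 𝔻.Cell (.single M.pro) f f N.pro) : VMonoidHom M N where
  hom := f
  cell := φ
  unit := Subsingleton.elim _ _
  mul := Subsingleton.elim _ _

theorem isBimoduleHom {c d c' d' : D} {M : 𝔻.VMonoid c} {N : 𝔻.VMonoid d} {M' : 𝔻.VMonoid c'}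
    {N' : 𝔻.VMonoid d'} (F : VMonoidHom M M') (G : VMonoidHom N N') (B : VBimodule M N)
    (B' : VBimodule M' N') (φ : 𝔻.Cell (.single B.pro) F.hom G.hom B'.pro) :
    IsBimoduleHom F G B B' φ :=
  ⟨Subsingleton.elim _ _, Subsingleton.elim _ _⟩

end VirtualDoubleCategory

namespace VirtualEquipment

variable {D : Type u} [Category.{v} D] {𝔼 : VirtualEquipment.{w, w'} D} [𝔼.IsFlat]

theorem exists_isKernel {a b : D} (f : a ⟶ b) : ∃ M : 𝔼.VMonoid a, IsKernel M f := by
  obtain ⟨P, φ, hφ⟩ := 𝔼.hasRestrictions f f (𝔼.U b)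
  have lift {x y : D} (R : 𝔼.Path x y) (h : x ⟶ a) (k : y ⟶ a) :=
    (isCartesian_iff_nonempty φ).1 hφ R h k
  obtain ⟨e⟩ := lift (.nil a) (𝟙 a) (𝟙 a) ⟨𝔼.comp (.nil f) (𝔼.η b) (by simp) (by simp)⟩
  obtain ⟨m⟩ := lift (.pair P P) (𝟙 a) (𝟙 a)
    ⟨𝔼.comp (.pair φ φ) (𝔼.lam (𝔼.U b)) (by simp) (by simp)⟩
  exact ⟨.ofCells P e m, .ofCell f φ, rfl, hφ⟩

theorem isCollapse_iff_existsUnique {c x : D} {M : 𝔼.VMonoid c} (F : 𝔼.Embedding M x) :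
    IsCollapse F ↔ ∀ {y : D} (f : c ⟶ y), Nonempty (𝔼.Cell (.single M.pro) f f (𝔼.U y)) →
      ∃! g : x ⟶ y, F.hom ≫ g = f := by
  have factors_iff {y : D} (G : 𝔼.Embedding M y) (g : x ⟶ y) :
      Factors F g G ↔ F.hom ≫ g = G.hom :=
    ⟨Factors.hom_eq, fun h => ⟨h, Subsingleton.elim _ _⟩⟩
  simp only [IsCollapse, factors_iff]
  exact ⟨fun h _ f ⟨φ⟩ => h (.ofCell f φ), fun h _ G => h G.hom ⟨G.cell⟩⟩

theorem isBimoduleCollapse_of_nonempty {c d x y : D} {M : 𝔼.VMonoid c} {N : 𝔼.VMonoid d}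
    {F : 𝔼.Embedding M x} {G : 𝔼.Embedding N y} {B : VBimodule M N} {P : 𝔼.Pro x y}
    {φ : 𝔼.Cell (.single B.pro) F.hom G.hom P} (hF : IsCollapse F) (hG : IsCollapse G)
    (h : ∀ {x' y' : D} (f : x ⟶ x') (g : y ⟶ y') (Q : 𝔼.Pro x' y'),
      Nonempty (𝔼.Cell (.single B.pro) (F.hom ≫ f) (G.hom ≫ g) Q) →
        Nonempty (𝔼.Cell (.single P) f g Q)) :
    IsBimoduleCollapse F G B P φ where
  left := hF
  right := hG
  embedding := isBimoduleHom F G B (𝔼.trivialBimodule P) φ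
  universal F' G' Q ψ _ f g hf hg := by
    obtain ⟨χ⟩ := h f g Q (by rw [hf.hom_eq, hg.hom_eq]; exact ⟨ψ⟩)
    exact ⟨χ, Subsingleton.elim _ _, fun _ _ => Subsingleton.elim _ _⟩

end VirtualEquipment

namespace InternalRel

section Category

variable {C : Type u} [Category.{v} C]

theorem factors_strongEpi_comp_iff {X Y Z : C} (S : MonoOver Z) (e : X ⟶ Y) [StrongEpi e]
    (t : Y ⟶ Z) : S.Factors (e ≫ t) ↔ S.Factors t := by
  refine ⟨fun ⟨m, hm⟩ => ?_, fun ⟨m, hm⟩ => ⟨e ≫ m, by rw [Category.assoc, hm]⟩⟩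
  have sq : CommSq m e S.arrow t := ⟨hm⟩
  exact ⟨sq.lift, sq.fac_right⟩

theorem exists_isPullback_iff_factors {X Y : C} (R : MonoOver X) (S : MonoOver Y) (h : X ⟶ Y) :
    (∃ m, IsPullback m R.arrow S.arrow h) ↔
      ∀ {T : C} (t : T ⟶ X), R.Factors t ↔ S.Factors (t ≫ h) := by
  constructor
  · rintro ⟨m, hm⟩ T t
    exact ⟨fun ⟨l, hl⟩ => ⟨l ≫ m, by rw [← hl, Category.assoc, Category.assoc, hm.w]⟩,
      fun ⟨l, hl⟩ => ⟨hm.lift l t hl, hm.lift_snd _ _ _⟩⟩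
  · intro H
    obtain ⟨m, hm⟩ := (H R.arrow).1 ⟨𝟙 _, Category.id_comp _⟩
    choose l hl using fun s : PullbackCone S.arrow h => (H s.snd).2 ⟨s.fst, s.condition⟩
    refine ⟨m, .of_isLimit' ⟨hm⟩ (PullbackCone.IsLimit.mk _ l (fun s => ?_) hl fun s n _ hn => ?_)⟩
    · rw [← cancel_mono S.arrow, Category.assoc, hm, reassoc_of% hl s, s.condition]
    · rw [← cancel_mono R.arrow, hl, hn]

theorem prod_map_mem [HasBinaryProducts C] (W : MorphismProperty C)
    [W.IsStableUnderBaseChange] [W.IsStableUnderComposition] {X Y X' Y' : C} {f : X ⟶ Y}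
    {g : X' ⟶ Y'} (hf : W f) (hg : W g) : W (prod.map f g) := by
  have map_id {A B : C} {k : A ⟶ B} (hk : W k) (Z : C) : W (prod.map k (𝟙 Z)) :=
    W.of_isPullback (.of_prod_fst_with_id k Z) hk
  have : prod.map (𝟙 Y) g =
      (prod.braiding Y X').hom ≫ prod.map g (𝟙 Y) ≫ (prod.braiding Y' Y).hom := by
    ext <;> simp [prod.lift_fst, prod.lift_snd, prod.lift_fst_assoc]
  have id_map : W (prod.map (𝟙 Y) g) := by
    rw [this, W.cancel_left_of_respectsIso, W.cancel_right_of_respectsIso]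
    exact map_id hg Y
  simpa using W.comp_mem _ _ (map_id hf X') id_map

/-- A span covers another one with the same feet if it maps to it by a regular epimorphism. Since
monomorphisms are orthogonal to regular epimorphisms, both spans then factor through the same
relations. -/
def Sp.Covers {a b : C} (X Y : Sp a b) : Prop :=
  ∃ e : X.apex ⟶ Y.apex, IsRegularEpi e ∧ e ≫ Y.l = X.l ∧ e ≫ Y.r = X.r

theorem Sp.Covers.refl {a b : C} (X : Sp a b) : X.Covers X :=
  ⟨𝟙 _, inferInstance, Category.id_comp _, Category.id_comp _⟩

end Category

section FiniteLimits

variable {C : Type u} [Category.{v} C] [HasFiniteLimits C]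

/-- The morphism from the apex of a span to the product of its feet, in the order used for
relations. -/
noncomputable abbrev Sp.toProd {a b : C} (X : Sp a b) : X.apex ⟶ b ⨯ a := prod.lift X.r X.l

theorem nonempty_cell_iff {a b c d : C} (P : (RelEquipment C).Path a b) (f : a ⟶ c) (g : b ⟶ d)
    (S : Relation c d) :
    Nonempty ((RelEquipment C).Cell P f g S) ↔
      MonoOver.Factors S ((span P).toProd ≫ prod.map g f) :=
  ⟨fun ⟨φ⟩ => ⟨RelCell.map φ, RelCell.w φ⟩, fun ⟨m, hm⟩ => ⟨⟨m, hm⟩⟩⟩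

theorem nonempty_cell_nil_iff {x c d : C} (f : x ⟶ c) (g : x ⟶ d) (S : Relation c d) :
    Nonempty ((RelEquipment C).Cell (.nil x) f g S) ↔ MonoOver.Factors S (prod.lift g f) := by
  have : (Sp.id x).toProd ≫ prod.map g f = prod.lift g f := by simp
  rw [← this]
  exact nonempty_cell_iff _ f g S

theorem nonempty_cell_single_iff {a b c d : C} (R : Relation a b) (f : a ⟶ c) (g : b ⟶ d)
    (S : Relation c d) :
    Nonempty ((RelEquipment C).Cell (.single R) f g S) ↔
      MonoOver.Factors S (R.arrow ≫ prod.map g f) := by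
  let e : (span (.single R)).apex ⟶ (R : C) := pullback.fst (tgt R) (𝟙 b)
  have : IsIso e := inferInstanceAs (IsIso (pullback.fst (tgt R) (𝟙 b)))
  have he : e ≫ R.arrow = (span (.single R)).toProd := by
    have w := (idRelCell R).w
    rwa [prod.map_id_id, Category.comp_id] at w
  rw [← factors_strongEpi_comp_iff S e, reassoc_of% he]
  exact nonempty_cell_iff _ f g S

instance relEquipment_isFlat : (RelEquipment C).IsFlat where
  subsingleton_cell _ _ _ _ := ⟨fun _ _ => Subsingleton.elim (α := RelCell _ _ _ _) _ _⟩

theorem isCartesian_iff_exists_isPullback {a b c d : C} {P : Relation a b} {Q : Relation c d}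
    {f : a ⟶ c} {g : b ⟶ d} (φ : (RelEquipment C).Cell (.single P) f g Q) :
    (RelEquipment C).IsCartesian φ ↔
      ∃ m, IsPullback m P.arrow Q.arrow (prod.map g f) := by
  rw [exists_isPullback_iff_factors]
  refine (isCartesian_iff_nonempty (𝔻 := (RelEquipment C).toVirtualDoubleCategory) φ).trans
    ⟨fun lift T t => ⟨fun ⟨l, hl⟩ => ?_, fun ht => ?_⟩, fun H x y R h k => ?_⟩
  · obtain ⟨m, hm⟩ := (nonempty_cell_single_iff P f g Q).1 ⟨φ⟩
    exact ⟨l ≫ m, by rw [Category.assoc, hm, reassoc_of% hl]⟩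
  · have ht' : Q.Factors (prod.lift ((t ≫ prod.fst) ≫ g) ((t ≫ prod.snd) ≫ f)) := by
      convert ht using 1
      ext <;> simp [prod.lift_fst, prod.lift_snd]
    have := (nonempty_cell_nil_iff _ _ P).1 (lift (.nil T) (t ≫ prod.snd) (t ≫ prod.fst)
      ((nonempty_cell_nil_iff _ _ Q).2 ht'))
    rwa [← prod.comp_lift, prod.lift_fst_snd, Category.comp_id] at this
  · refine fun hψ => (nonempty_cell_iff R h k P).2 ((H _).2 ?_)
    have := (nonempty_cell_iff R _ _ Q).1 hψ
    rwa [Category.assoc, prod.map_map]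

theorem diagRel_factors_iff {T x : C} (t : T ⟶ x ⨯ x) :
    (diagRel x).Factors t ↔ t ≫ prod.fst = t ≫ prod.snd := by
  constructor
  · rintro ⟨m, rfl⟩
    rw [Category.assoc, Category.assoc]
    exact congrArg (m ≫ ·) (src_diagRel x).symm
  · intro h
    refine ⟨t ≫ prod.fst, ?_⟩
    change (t ≫ prod.fst) ≫ diag x = t
    ext <;> simp [prod.lift_fst, prod.lift_snd, h]

theorem nonempty_cell_unit_iff {a b x : C} (R : Relation a b) (f : a ⟶ x) (g : b ⟶ x) :
    Nonempty ((RelEquipment C).Cell (.single R) f g (diagRel x)) ↔ tgt R ≫ g = src R ≫ f := by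
  refine (nonempty_cell_single_iff R f g (diagRel x)).trans ?_
  rw [diagRel_factors_iff]
  simp

theorem isKernelPair_iff_factors {a b : C} (R : Relation a a) (f : a ⟶ b) :
    IsKernelPair f (tgt R) (src R) ↔
      ∀ {T : C} (t : T ⟶ a ⨯ a), R.Factors t ↔ (t ≫ prod.fst) ≫ f = (t ≫ prod.snd) ≫ f := by
  constructor
  · intro h T t
    refine ⟨?_, fun ht => ⟨h.lift _ _ ht, ?_⟩⟩
    · rintro ⟨l, rfl⟩
      simpa using l ≫= h.w
    · ext <;> simp [h.lift_fst, h.lift_snd]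
  · intro H
    have w : tgt R ≫ f = src R ≫ f := (H R.arrow).1 ⟨𝟙 _, Category.id_comp _⟩
    choose l hl using fun s : PullbackCone f f =>
      (H (prod.lift s.fst s.snd)).2 (by rw [prod.lift_fst, prod.lift_snd, s.condition])
    refine .of_isLimit' ⟨w⟩ (PullbackCone.IsLimit.mk _ l (fun s => ?_) (fun s => ?_)
      fun s n hn hn' => ?_)
    · rw [reassoc_of% hl s, prod.lift_fst]
    · rw [reassoc_of% hl s, prod.lift_snd]
    · rw [← cancel_mono R.arrow, hl]
      ext
      · rw [Category.assoc, hn, prod.lift_fst]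
      · rw [Category.assoc, hn', prod.lift_snd]

theorem isKernel_iff_isKernelPair {a b : C} (M : (RelEquipment C).VMonoid a) (f : a ⟶ b) :
    VirtualEquipment.IsKernel M f ↔ IsKernelPair f (tgt (monRel M)) (src (monRel M)) := by
  have pullback_iff : (∃ m, IsPullback m (monRel M).arrow (diagRel b).arrow (prod.map f f)) ↔
      IsKernelPair f (tgt (monRel M)) (src (monRel M)) := by
    simp only [exists_isPullback_iff_factors, isKernelPair_iff_factors, diagRel_factors_iff,
      Category.assoc, prod.map_fst, prod.map_snd]
  constructor
  · rintro ⟨F, rfl, hF⟩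
    exact pullback_iff.1 ((isCartesian_iff_exists_isPullback _).1 hF)
  · intro h
    obtain ⟨φ⟩ := (nonempty_cell_unit_iff (monRel M) f f).2 h.w
    exact ⟨.ofCell f φ, rfl, (isCartesian_iff_exists_isPullback φ).2 (pullback_iff.2 h)⟩

theorem embedding_w {a x : C} {M : (RelEquipment C).VMonoid a}
    (F : (RelEquipment C).Embedding M x) : tgt (monRel M) ≫ F.hom = src (monRel M) ≫ F.hom :=
  (nonempty_cell_unit_iff (monRel M) _ _).1 ⟨F.cell⟩

theorem isCollapse_iff_isColimit {a x : C} {M : (RelEquipment C).VMonoid a}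
    (F : (RelEquipment C).Embedding M x) :
    VirtualEquipment.IsCollapse F ↔ Nonempty (IsColimit (Cofork.ofπ F.hom (embedding_w F))) := by
  rw [VirtualEquipment.isCollapse_iff_existsUnique]
  constructor
  · intro h
    exact ⟨Cofork.IsColimit.ofExistsUnique fun s =>
      h s.π ((nonempty_cell_unit_iff (monRel M) _ _).2 s.condition)⟩
  · rintro ⟨hF⟩ y f hf
    exact Cofork.IsColimit.existsUnique hF f ((nonempty_cell_unit_iff (monRel M) f f).1 hf)

theorem isRegularEpi_of_isCollapse {a x : C} {M : (RelEquipment C).VMonoid a}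
    {F : (RelEquipment C).Embedding M x} (hF : VirtualEquipment.IsCollapse F) :
    IsRegularEpi F.hom :=
  have ⟨hc⟩ := (isCollapse_iff_isColimit F).1 hF
  ⟨⟨⟨_, _, _, embedding_w F, hc⟩⟩⟩

theorem isNormalCollapse_of_isCollapse {a x : C} {M : (RelEquipment C).VMonoid a}
    {F : (RelEquipment C).Embedding M x} (hF : VirtualEquipment.IsCollapse F) :
    VirtualEquipment.IsNormalCollapse F := by
  have := isRegularEpi_of_isCollapse hF
  refine ⟨hF, VirtualEquipment.isBimoduleCollapse_of_nonempty hF hF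
    fun {x' y'} f g (Q : Relation x' y') ⟨ψ⟩ => ?_⟩
  have hQ : Q.Factors (prod.lift (F.hom ≫ g) (F.hom ≫ f)) := (nonempty_cell_nil_iff _ _ Q).1
    ⟨(RelEquipment C).comp (.single M.e) ψ (Category.id_comp _) (Category.id_comp _)⟩
  rw [← prod.comp_lift, factors_strongEpi_comp_iff] at hQ
  refine (nonempty_cell_single_iff (diagRel x) f g Q).2 ?_
  change Q.Factors (diag x ≫ prod.map g f)
  rwa [prod.lift_map, Category.id_comp, Category.id_comp]

theorem exists_isNormalCollapse_iff {a x : C} (M : (RelEquipment C).VMonoid a) (q : a ⟶ x)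
    (hq : tgt (monRel M) ≫ q = src (monRel M) ≫ q) :
    (∃ F : (RelEquipment C).Embedding M x, F.hom = q ∧ VirtualEquipment.IsNormalCollapse F) ↔
      Nonempty (IsColimit (Cofork.ofπ q hq)) := by
  constructor
  · rintro ⟨F, rfl, hF⟩
    exact (isCollapse_iff_isColimit F).1 hF.1
  · intro h
    obtain ⟨φ⟩ := (nonempty_cell_unit_iff (monRel M) q q).2 hq
    exact ⟨.ofCell q φ, rfl, isNormalCollapse_of_isCollapse ((isCollapse_iff_isColimit _).2 h)⟩

namespace Sp

theorem Covers.factors {a b c d : C} {X Y : Sp a b} (h : X.Covers Y) {f : a ⟶ c} {g : b ⟶ d}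
    {S : Relation c d} (hX : S.Factors (X.toProd ≫ prod.map g f)) :
    S.Factors (Y.toProd ≫ prod.map g f) := by
  obtain ⟨e, _, hl, hr⟩ := h
  have he : X.toProd = e ≫ Y.toProd := by rw [prod.comp_lift, hl, hr]
  rwa [he, Category.assoc, factors_strongEpi_comp_iff] at hX

theorem covers_id_comp {a b : C} (X : Sp a b) : X.Covers ((Sp.id a).comp X) := by
  refine ⟨inv (pullback.snd (𝟙 a) X.l), inferInstance, ?_, ?_⟩
  · rw [IsIso.inv_comp_eq]
    exact pullback.condition (f := 𝟙 a) (g := X.l)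
  · rw [IsIso.inv_hom_id_assoc]

theorem covers_comp_assoc {a b c d : C} (X : Sp a b) (Y : Sp b c) (Z : Sp c d) :
    (X.comp (Y.comp Z)).Covers ((X.comp Y).comp Z) := by
  refine ⟨(pullbackAssoc X.r Y.l Y.r Z.l).inv, inferInstance, ?_, ?_⟩
  · simp [pullbackAssoc_inv_fst_fst_assoc]
  · simp [pullbackAssoc_inv_snd_assoc]

end Sp

end FiniteLimits

section Regular

variable {C : Type u} [Category.{v} C] [Regular C]

attribute [local instance] Regular.regularEpiIsStableUnderBaseChange

instance regularEpi_isStableUnderComposition :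
    (MorphismProperty.regularEpi C).IsStableUnderComposition where
  comp_mem f g (_ : IsRegularEpi f) (_ : IsRegularEpi g) :=
    have := strongEpi_comp f g
    inferInstanceAs (IsRegularEpi (f ≫ g))

namespace Sp

theorem Covers.trans {a b : C} {X Y Z : Sp a b} (h : X.Covers Y) (h' : Y.Covers Z) :
    X.Covers Z := by
  obtain ⟨e, he, hl, hr⟩ := h
  obtain ⟨e', he', hl', hr'⟩ := h'
  exact ⟨e ≫ e', (MorphismProperty.regularEpi C).comp_mem e e' he he',
    by rw [Category.assoc, hl', hl], by rw [Category.assoc, hr', hr]⟩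

theorem Covers.comp {a b c : C} {X X' : Sp a b} {Y Y' : Sp b c} (hX : X.Covers X')
    (hY : Y.Covers Y') : (X.comp Y).Covers (X'.comp Y') := by
  obtain ⟨e, he, hl, hr⟩ := hX
  obtain ⟨e', he', hl', hr'⟩ := hY
  refine ⟨pullback.map X.r Y.l X'.r Y'.l e e' (𝟙 b) (by simp [hr]) (by simp [hl']),
    MorphismProperty.pullbackMap (P := .regularEpi C) he he' hr.symm hl'.symm, ?_, ?_⟩
  · simp [pullback.lift_fst_assoc, hl]
  · simp [pullback.lift_snd_assoc, hr']

end Sp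

theorem span_append_covers {a b c : C} (P : ProPath (Relation (C := C)) a b)
    (S : ProPath (Relation (C := C)) b c) :
    (span (P.append S)).Covers ((span P).comp (span S)) := by
  induction P with
  | nil => exact Sp.covers_id_comp _
  | cons A P ih => exact ((Sp.Covers.refl _).comp (ih S)).trans (Sp.covers_comp_assoc _ _ _)

theorem span_append_covers_of_covers {a b c d : C} {P : ProPath (Relation (C := C)) b c}
    {Q : Relation b c} (h : (span P).Covers (Sp.ofRel Q)) (R : ProPath (Relation (C := C)) a b)
    (S : ProPath (Relation (C := C)) c d) :
    (span (R.append (P.append S))).Covers (span (R.append (.cons Q S))) := by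
  induction R with
  | nil => exact (span_append_covers P S).trans (h.comp (.refl _))
  | cons A R ih => exact (Sp.Covers.refl _).comp (ih h)

theorem isOpcartesian_of_covers {a b : C} {P : (RelEquipment C).Path a b} {Q : Relation a b}
    (φ : (RelEquipment C).Cell P (𝟙 a) (𝟙 b) Q) (h : (span P).Covers (Sp.ofRel Q)) :
    (RelEquipment C).IsOpcartesian φ :=
  (isOpcartesian_iff_nonempty (𝔻 := (RelEquipment C).toVirtualDoubleCategory) φ).2
    fun R S f g T hψ => (nonempty_cell_iff _ f g T).2
      ((span_append_covers_of_covers h R S).factors ((nonempty_cell_iff _ f g T).1 hψ))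

theorem relEquipment_hasComposites : (RelEquipment C).HasComposites := by
  intro a b P
  let F := Regular.strongEpiMonoFactorisation (span P).toProd
  let Q : Relation a b := MonoOver.mk F.m
  have he : IsRegularEpi F.e :=
    inferInstanceAs (IsRegularEpi (Regular.strongEpiMonoFactorisation _).e)
  have hl : F.e ≫ src Q = (span P).l := by
    change F.e ≫ F.m ≫ prod.snd = _
    rw [reassoc_of% F.fac, prod.lift_snd]
  have hr : F.e ≫ tgt Q = (span P).r := by
    change F.e ≫ F.m ≫ prod.fst = _
    rw [reassoc_of% F.fac, prod.lift_fst]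
  obtain ⟨φ⟩ := (nonempty_cell_iff P (𝟙 a) (𝟙 b) Q).2 ⟨F.e, F.fac.trans (by simp)⟩
  exact ⟨Q, φ, isOpcartesian_of_covers φ ⟨F.e, he, hl, hr⟩⟩

theorem isCollapse_of_isKernelCell {a x : C} {M : (RelEquipment C).VMonoid a}
    {F : (RelEquipment C).Embedding M x} (hF : VirtualEquipment.IsKernelCell F)
    [IsRegularEpi F.hom] : VirtualEquipment.IsCollapse F :=
  have hM := (isKernel_iff_isKernelPair M F.hom).1 ⟨F, rfl, hF⟩
  (isCollapse_iff_isColimit F).2 ⟨hM.toCoequalizer'⟩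

theorem exists_isNormalCollapse_of_isEffective {a : C} (M : (RelEquipment C).VMonoid a)
    (hM : VirtualEquipment.IsEffective M) :
    ∃ (x : C) (F : (RelEquipment C).Embedding M x), VirtualEquipment.IsNormalCollapse F := by
  obtain ⟨b, f, hf⟩ := hM
  have := Regular.hasCoequalizer_of_isKernelPair ((isKernel_iff_isKernelPair M f).1 hf)
  obtain ⟨F, -, hF⟩ := (exists_isNormalCollapse_iff M _ (coequalizer.condition _ _)).2
    ⟨coequalizerIsCoequalizer _ _⟩
  exact ⟨_, F, hF⟩

theorem nonempty_cell_of_isCartesian {a b a' b' c d : C} {A : Relation a b} {B : Relation a' b'}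
    {p : a ⟶ a'} {q : b ⟶ b'} [IsRegularEpi p] [IsRegularEpi q]
    {φ : (RelEquipment C).Cell (.single A) p q B} (hφ : (RelEquipment C).IsCartesian φ)
    {f : a' ⟶ c} {g : b' ⟶ d} {Q : Relation c d}
    (hQ : Nonempty ((RelEquipment C).Cell (.single A) (p ≫ f) (q ≫ g) Q)) :
    Nonempty ((RelEquipment C).Cell (.single B) f g Q) := by
  obtain ⟨m, hm⟩ := (isCartesian_iff_exists_isPullback φ).1 hφ
  have : IsRegularEpi m := (MorphismProperty.regularEpi C).of_isPullback hm.flip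
    (prod_map_mem _ ‹IsRegularEpi q› ‹IsRegularEpi p›)
  have hA := (nonempty_cell_single_iff A _ _ Q).1 hQ
  rw [← prod.map_map, ← reassoc_of% hm.w, factors_strongEpi_comp_iff] at hA
  exact (nonempty_cell_single_iff B f g Q).2 hA

theorem relEquipment_isRegular : (RelEquipment C).IsRegular where
  exists_normalCollapse := exists_isNormalCollapse_of_isEffective
  isBimoduleCollapse B M N F G hF hG hFcover hGcover A φ _ hφ := by
    obtain ⟨_, F', hF', -, hF'coll⟩ := hFcover
    obtain ⟨_, G', hG', -, hG'coll⟩ := hGcover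
    have : IsRegularEpi F.hom := hF' ▸ isRegularEpi_of_isCollapse hF'coll.1
    have : IsRegularEpi G.hom := hG' ▸ isRegularEpi_of_isCollapse hG'coll.1
    exact VirtualEquipment.isBimoduleCollapse_of_nonempty (isCollapse_of_isKernelCell hF)
      (isCollapse_of_isKernelCell hG) fun f g Q => nonempty_cell_of_isCartesian hφ

end Regular

end InternalRel

theorem mainTheorem5_general {C : Type u} [Category.{v} C] [Regular C] :
    (InternalRel.RelEquipment C).HasComposites ∧
    (InternalRel.RelEquipment C).IsRegular ∧
    (∀ {a b : C} (f : a ⟶ b),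
      ∃ M : (InternalRel.RelEquipment C).VMonoid a, VirtualEquipment.IsKernel M f) ∧
    (∀ {a b : C} (M : (InternalRel.RelEquipment C).VMonoid a) (f : a ⟶ b),
      VirtualEquipment.IsKernel M f ↔
        IsKernelPair f (InternalRel.tgt (InternalRel.monRel M))
          (InternalRel.src (InternalRel.monRel M))) ∧
    (∀ {a x : C} (M : (InternalRel.RelEquipment C).VMonoid a) (q : a ⟶ x)
      (hq : InternalRel.tgt (InternalRel.monRel M) ≫ q =
        InternalRel.src (InternalRel.monRel M) ≫ q),
      (∃ F : (InternalRel.RelEquipment C).Embedding M x,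
        F.hom = q ∧ VirtualEquipment.IsNormalCollapse F) ↔
          Nonempty (IsColimit (Cofork.ofπ q hq))) :=
  ⟨InternalRel.relEquipment_hasComposites, InternalRel.relEquipment_isRegular,
    VirtualEquipment.exists_isKernel, InternalRel.isKernel_iff_isKernelPair,
    InternalRel.exists_isNormalCollapse_iff⟩

theorem mainTheorem5 {C : Type u} [Category.{v} C] [Regular C] :
    -- the virtual equipment of relations has all composites, so it is an equipment, and is regular
    (InternalRel.RelEquipment C).HasComposites ∧
    (InternalRel.RelEquipment C).IsRegular ∧
    -- every morphism has a kernel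
    (∀ {a b : C} (f : a ⟶ b),
      ∃ M : (InternalRel.RelEquipment C).VMonoid a, VirtualEquipment.IsKernel M f) ∧
    -- a monoid is the kernel of `f` if and only if it is the kernel pair of `f`
    (∀ {a b : C} (M : (InternalRel.RelEquipment C).VMonoid a) (f : a ⟶ b),
      VirtualEquipment.IsKernel M f ↔
        IsKernelPair f (InternalRel.tgt (InternalRel.monRel M))
          (InternalRel.src (InternalRel.monRel M))) ∧
    -- a coequalizer of an effective monoid is a normal collapse
    (∀ {a x : C} (M : (InternalRel.RelEquipment C).VMonoid a), VirtualEquipment.IsEffective M →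
      ∀ (q : a ⟶ x)
        (hq : InternalRel.tgt (InternalRel.monRel M) ≫ q =
          InternalRel.src (InternalRel.monRel M) ≫ q),
        Nonempty (IsColimit (Cofork.ofπ q hq)) →
          ∃ F : (InternalRel.RelEquipment C).Embedding M x,
            F.hom = q ∧ VirtualEquipment.IsNormalCollapse F) := by
  obtain ⟨composites, regular, kernels, isKernel_iff, normalCollapse_iff⟩ :=
    mainTheorem5_general (C := C)
  exact ⟨composites, regular, kernels, isKernel_iff, fun M _ q hq => (normalCollapse_iff M q hq).2⟩
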